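/- **Theorem 2 (Almost sure rate for single-trajectory generalized TD).** Consider a discounted Markov decision process with finite state space $\mathcal S$, finite action space $\mathcal A$, discount factor $\gamma\in(0,1)$, transition probabilities $p(s'\mid s,a)$ and reward function $r:\mathcal S\times\mathcal A\to\mathbb R$. Let $\pi_b$ be a behavior policy with $\pi_b(a\mid s)>0$ for all $(s,a)$, and assume that the state-action chain with transition probabilities $p(s'\mid s,a)\,\pi_b(a'\mid s')$ is irreducible and aperiodic. Let $(S_t,A_t)_{t\ge0}$ be a trajectory generated by $A_t\sim\pi_b(\cdot\mid S_t)$, $S_{t+1}\sim p(\cdot\mid S_t,A_t)$, with an arbitrary initial law of $S_0$. Fix $N\ge1$, a feature map $\phi:\mathcal S\times\mathcal A\to\mathbb R^d$ and factors $c,\rho:\mathcal S\times\mathcal A\to[0,\infty)$. Let $Y_n=(S_n,A_n,\dots,S_{n+N},A_{n+N})$ and let $\varpi$ be the invariant distribution of the Markov chain $(Y_n)$ of windows. For a window $y=(s_0,a_0,\dots,s_N,a_N)$ write $\phi_i=\phi(s_i,a_i)$, $c_i=c(s_i,a_i)$, $\rho_i=\rho(s_i,a_i)$ and put $$g(w,y)=\phi_0\sum_{i=0}^{N-1}\gamma^i\Big(\prod_{j=1}^{i}c_j\Big)\big(r(s_i,a_i)+\gamma\rho_{i+1}\phi_{i+1}^\top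 w-\phi_i^\top w\big)=A(y)w-b(y),$$ where $$A(y)=\phi_0\sum_{i=0}^{N-1}\gamma^i\Big(\prod_{j=1}^{i}c_j\Big)(\gamma\rho_{i+1}\phi_{i+1}-\phi_i)^\top,\qquad b(y)=-\phi_0\sum_{i=0}^{N-1}\gamma^i\Big(\prod_{j=1}^{i}c_j\Big)r(s_i,a_i).$$ Let $\bar A=\mathbb E_{\varpi}[A(Y)]$ and $\bar b=\mathbb E_{\varpi}[b(Y)]$, assume that $\bar A$ is Hurwitz (all its eigenvalues have negative real part), and let $w^*=\bar A^{-1}\bar b$. Let $w_0\in\mathbb R^d$ be deterministic and $$w_{n+1}=w_n+a_n\,g(w_n,Y_n),\qquad a_n=\frac{a}{(n+1)^\eta},\qquad a>0,\quad \tfrac12<\eta\le1.$$ Then there exist $\beta>0$, a norm $\|\cdot\|_{\rm GTD}$ on $\mathbb R^d$ and $\kappa\in(0,1)$ such that $T(w)=w+\beta(\bar Aw-\bar b)$ satisfies $\|T(w)-T(w')\|_{\rm GTD}\le\kappa\|w-w'\|_{\rm GTD}$ for all $w,w'\in\mathbb R^d$; and for every such choice of $\beta$, $\|\cdot\|_{\rm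 GTD}$ and $\kappa$, $$(n+1)^\zeta\,\|w_n-w^*\|_{\rm GTD}^2\longrightarrow0\quad\text{almost surely}$$ for every $\zeta\in(0,2\eta-1)$ if $\tfrac12<\eta<1$, and for every $\zeta\in\big(0,\min\{1,\,2(1-\kappa)a/\beta\}\big)$ if $\eta=1$. -/

import Mathlib

open Filter Topology MeasureTheory

/-- A finite discounted Markov decision process with state space `S` and action space `A`:
`trans s a s'` is the probability of moving to `s'` when action `a` is taken in state `s`. -/
structure FiniteMDP (S A : Type*) [Fintype S] where
  trans : S → A → S → ℝ
  trans_nonneg : ∀ s a s', 0 ≤ trans s a s'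
  trans_sum : ∀ s a, ∑ s', trans s a s' = 1
  reward : S × A → ℝ
  discount : ℝ
  discount_pos : 0 < discount
  discount_lt_one : discount < 1

/-- A stationary randomized policy: `prob s a` is the probability of action `a` in state `s`. -/
structure RandPolicy (S A : Type*) [Fintype A] where
  prob : S → A → ℝ
  prob_nonneg : ∀ s a, 0 ≤ prob s a
  prob_sum : ∀ s, ∑ a, prob s a = 1

/-- A window `(s₀, a₀, s₁, a₁, …, s_N, a_N)` of `N + 1` consecutive state-action pairs. -/
abbrev Window (S A : Type*) (N : ℕ) : Type _ := Fin (N + 1) → S × A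

/-- A finite Markov chain with transition matrix `P` is aperiodic: for every state `x`, the
greatest common divisor of the possible return times `{k ≥ 1 : (P ^ k) x x > 0}` is one. -/
def IsAperiodicChain {X : Type*} [Fintype X] [DecidableEq X] (P : Matrix X X ℝ) : Prop :=
  ∀ x, ∀ m : ℕ, (∀ k : ℕ, 0 < k → 0 < (P ^ k) x x → m ∣ k) → m = 1

/-- `q` is an invariant probability distribution of the finite Markov chain with transition
matrix `P`. -/
structure IsInvariantDistribution {X : Type*} [Fintype X] (P : Matrix X X ℝ) (q : X → ℝ) :
    Prop where
  nonneg : ∀ x, 0 ≤ q x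
  sum_eq_one : ∑ x, q x = 1
  invariant : ∀ y, ∑ x, q x * P x y = q y

/-- A real square matrix is Hurwitz: all its complex eigenvalues have negative real part. -/
def IsHurwitz {d : ℕ} (M : Matrix (Fin d) (Fin d) ℝ) : Prop :=
  ∀ z ∈ spectrum ℂ (M.map Complex.ofReal), z.re < 0

namespace FiniteMDP

variable {S A : Type*} [Fintype S] [Fintype A]

/-- Transition matrix of the state-action chain `(S_t, A_t)` under the policy `b`. -/
def stateActionMatrix (M : FiniteMDP S A) (b : RandPolicy S A) : Matrix (S × A) (S × A) ℝ :=
  fun x x' => M.trans x.1 x.2 x'.1 * b.prob x'.1 x'.2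

open Classical in
/-- Transition matrix of the window chain `Y_n = (S_n, A_n, …, S_{n+N}, A_{n+N})` under the
policy `b`: the window is shifted by one and a new state-action pair is appended. -/
noncomputable def windowMatrix (M : FiniteMDP S A) (b : RandPolicy S A) (N : ℕ) :
    Matrix (Window S A N) (Window S A N) ℝ :=
  fun y y' =>
    if ∀ i : Fin N, y' i.castSucc = y i.succ then
      M.stateActionMatrix b (y (Fin.last N)) (y' (Fin.last N))
    else 0

/-- The random sequence `(St t, Act t)` on the probability space `(Ω, μ)` is a trajectory of the
MDP under the policy `b`, with arbitrary initial state: given the past,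
`Act t ∼ b (· | St t)` and `St (t + 1) ∼ p (· | St t, Act t)`. The conditional laws are written
on the events fixing a finite history `h`. -/
structure IsTrajectory (M : FiniteMDP S A) (b : RandPolicy S A) {Ω : Type*} [MeasurableSpace Ω]
    (μ : Measure Ω) (St : ℕ → Ω → S) (Act : ℕ → Ω → A) : Prop where
  measurable_state : ∀ t s, MeasurableSet {ω | St t ω = s}
  measurable_action : ∀ t a, MeasurableSet {ω | Act t ω = a}
  action_law : ∀ (t : ℕ) (h : ℕ → S × A) (s : S) (a : A),
    μ.real {ω | (∀ i < t, (St i ω, Act i ω) = h i) ∧ St t ω = s ∧ Act t ω = a} =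
      μ.real {ω | (∀ i < t, (St i ω, Act i ω) = h i) ∧ St t ω = s} * b.prob s a
  state_law : ∀ (t : ℕ) (h : ℕ → S × A) (s' : S),
    μ.real {ω | (∀ i ≤ t, (St i ω, Act i ω) = h i) ∧ St (t + 1) ω = s'} =
      μ.real {ω | ∀ i ≤ t, (St i ω, Act i ω) = h i} * M.trans (h t).1 (h t).2 s'

/-- The data window `Y_n = (S_n, A_n, …, S_{n+N}, A_{n+N})` of a trajectory. -/
def dataWindow {S A Ω : Type*} (N : ℕ) (St : ℕ → Ω → S) (Act : ℕ → Ω → A) (n : ℕ) (ω : Ω) :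
    Window S A N :=
  fun i => (St (n + i) ω, Act (n + i) ω)

/-- The product `∏_{j=1}^{i} c(s_j, a_j)` along a window (equal to one for `i = 0`). -/
def traceProd {S A : Type*} {N : ℕ} (c : S × A → ℝ) (y : Window S A N) (i : Fin N) : ℝ :=
  ∏ j ∈ Finset.Ioc 0 i.castSucc, c (y j)

section GeneralizedTD

variable {d N : ℕ} (M : FiniteMDP S A) (φ : S × A → Fin d → ℝ) (c ρ : S × A → ℝ)

/-- The temporal difference
`δ_i(w; y) = r(s_i, a_i) + γ ρ(s_{i+1}, a_{i+1}) φ(s_{i+1}, a_{i+1})ᵀ w - φ(s_i, a_i)ᵀ w`. -/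
def tdError (w : Fin d → ℝ) (y : Window S A N) (i : Fin N) : ℝ :=
  M.reward (y i.castSucc) + M.discount * ρ (y i.succ) * (φ (y i.succ) ⬝ᵥ w)
    - φ (y i.castSucc) ⬝ᵥ w

/-- The generalized TD increment
`g(w, y) = φ(s₀, a₀) ∑_{i<N} γ^i (∏_{j=1}^{i} c(s_j, a_j)) δ_i(w; y)`. -/
def gtdIncrement (w : Fin d → ℝ) (y : Window S A N) : Fin d → ℝ :=
  (∑ i : Fin N, M.discount ^ (i : ℕ) * traceProd c y i * M.tdError φ ρ w y i) • φ (y 0)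

/-- The matrix `A(y) = φ₀ ∑_{i<N} γ^i (∏_{j=1}^{i} c_j) (γ ρ_{i+1} φ_{i+1} - φ_i)ᵀ`. -/
def gtdMatrix (y : Window S A N) : Matrix (Fin d) (Fin d) ℝ :=
  Matrix.vecMulVec (φ (y 0))
    (∑ i : Fin N, (M.discount ^ (i : ℕ) * traceProd c y i) •
      ((M.discount * ρ (y i.succ)) • φ (y i.succ) - φ (y i.castSucc)))

/-- The vector `b(y) = -φ₀ ∑_{i<N} γ^i (∏_{j=1}^{i} c_j) r(s_i, a_i)`, so that
`g(w, y) = A(y) w - b(y)`. -/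
def gtdVector (y : Window S A N) : Fin d → ℝ :=
  -((∑ i : Fin N, M.discount ^ (i : ℕ) * traceProd c y i * M.reward (y i.castSucc)) • φ (y 0))

/-- The mean matrix `Ā = E_ϖ[A(Y)]`. -/
def gtdMeanMatrix (q : Window S A N → ℝ) : Matrix (Fin d) (Fin d) ℝ :=
  ∑ y, q y • M.gtdMatrix φ c ρ y

/-- The mean vector `b̄ = E_ϖ[b(Y)]`. -/
def gtdMeanVector (q : Window S A N → ℝ) : Fin d → ℝ :=
  ∑ y, q y • M.gtdVector φ c y

/-- The mean root `w* = Ā⁻¹ b̄` (used only when `Ā` is Hurwitz, hence nonsingular). -/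
noncomputable def gtdRoot (q : Window S A N → ℝ) : Fin d → ℝ :=
  Matrix.mulVec (M.gtdMeanMatrix φ c ρ q)⁻¹ (M.gtdMeanVector φ c q)

/-- The averaged map `T(w) = w + β (Ā w - b̄)`. -/
def gtdMap (q : Window S A N → ℝ) (β : ℝ) (w : Fin d → ℝ) : Fin d → ℝ :=
  w + β • (Matrix.mulVec (M.gtdMeanMatrix φ c ρ q) w - M.gtdMeanVector φ c q)

/-- `β > 0`, `nrm` is a norm on `ℝ^d` (a seminorm that vanishes only at zero), `κ ∈ (0, 1)`, and
`T(w) = w + β (Ā w - b̄)` is a `κ`-contraction for `nrm`. -/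
structure IsGTDContraction (q : Window S A N → ℝ) (β : ℝ) (nrm : Seminorm ℝ (Fin d → ℝ))
    (κ : ℝ) : Prop where
  β_pos : 0 < β
  κ_pos : 0 < κ
  κ_lt_one : κ < 1
  norm_definite : ∀ w, nrm w = 0 → w = 0
  contraction : ∀ w w', nrm (M.gtdMap φ c ρ q β w - M.gtdMap φ c ρ q β w') ≤ κ * nrm (w - w')

/-- The generalized TD iterates driven by a sequence of windows `y`, with step sizes
`a_n = a / (n + 1) ^ η`: `w_0 = w₀` and `w_{n+1} = w_n + a_n g(w_n, y_n)`. -/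
noncomputable def gtdIterate (a η : ℝ) (w₀ : Fin d → ℝ) (y : ℕ → Window S A N) :
    ℕ → (Fin d → ℝ)
  | 0 => w₀
  | n + 1 => gtdIterate a η w₀ y n +
      (a / ((n : ℝ) + 1) ^ η) • M.gtdIncrement φ c ρ (gtdIterate a η w₀ y n) (y n)

end GeneralizedTD

end FiniteMDP

/-! The increment is affine in the iterate, so `x n = w n - w*` satisfies `x (n+1) = x n + α n • (A
(Y n) (x n) + ξ (Y n))`, where `ξ y = A(y) w* - b(y)` has mean zero under the invariant law. Both
`A(Y n) - Ā` and `ξ (Y n)` are thus centred functions of a finite chain, and no a priori bound on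
the iterates is needed.

Probability enters only in `IsTrajectory.ae_exists_tendsto_sum`: for exponents `s > 1/2`, the sums
of `(k+1)^(-s) f(Y k)` converge almost surely for centred `f`. The Poisson equation splits `f(Y k)`
into a martingale difference and a telescoping term. Taking `s = η - r` with `r < η - 1/2`, Abel
summation (`exists_tail_of_tendsto_sum`) makes the tails `R n`, `U n` of the step-size weighted
noise `O(n^(-r))`.

The rest is pathwise. Passing to `x + R x + U` replaces the noise by an error of relative size
`n^(-r)` (`exists_eventually_seminorm_le`). Contraction of `I + βĀ` gives, by convexity, the factor
`1 - (1-κ)/β · α n` for small steps, and a scalar recursion (`exists_eventually_le_of_recursion`)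
yields `‖x n‖ = O(n^(-r))`. Choosing `2r > ζ` finishes the proof. A contracting norm exists because
`I + βĀ` has spectral radius below one for small `β`. -/

/-! ### Harmonic functions and the Poisson equation -/

open Matrix in
/-- A harmonic function of an irreducible stochastic matrix is constant. -/
lemma Matrix.IsIrreducible.eq_of_mulVec_eq {X : Type*} [Fintype X] [DecidableEq X]
    {K : Matrix X X ℝ} (hK : K.IsIrreducible) (hsum : ∀ x, ∑ y, K x y = 1) {u : X → ℝ}
    (hu : K *ᵥ u = u) (x y : X) : u x = u y := by
  have hone : K *ᵥ (fun _ => 1) = fun _ => (1 : ℝ) := by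
    ext x; simp [mulVec, dotProduct, hsum]
  have hpow : ∀ {v : X → ℝ}, K *ᵥ v = v → ∀ k : ℕ, (K ^ k) *ᵥ v = v := by
    intro v hv k
    induction k with
    | zero => simp
    | succ k ih => rw [pow_succ, ← mulVec_mulVec, hv, ih]
  have hnn : ∀ (k : ℕ) (i j : X), 0 ≤ (K ^ k) i j := by
    intro k
    induction k with
    | zero => intro i j; rw [pow_zero, one_apply]; split_ifs <;> norm_num
    | succ k ih =>
      intro i j
      rw [pow_succ, mul_apply]
      exact Finset.sum_nonneg fun l _ => mul_nonneg (ih i l) (hK.nonneg l j)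
  -- Maximum principle: `u m` is the average of `u` under row `m` of `K ^ k`, so every `j` with
  -- positive weight attains the maximum.
  obtain ⟨m, -, hm⟩ := Finset.exists_max_image Finset.univ u ⟨x, Finset.mem_univ x⟩
  have key : ∀ j, u j = u m := by
    intro j
    obtain ⟨k, -, hk⟩ := (isIrreducible_iff_exists_pow_pos hK.nonneg).1 hK m j
    have h1 : ∑ l, (K ^ k) m l = 1 := by
      simpa [mulVec, dotProduct] using congrFun (hpow hone k) m
    have h2 : ∑ l, (K ^ k) m l * u l = u m := by
      simpa [mulVec, dotProduct] using congrFun (hpow hu k) m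
    have h3 : ∑ l, (K ^ k) m l * (u m - u l) = 0 := by
      simp only [mul_sub, Finset.sum_sub_distrib, ← Finset.sum_mul, h1, h2]; ring
    have h4 := (Finset.sum_eq_zero_iff_of_nonneg fun l _ =>
      mul_nonneg (hnn k m l) (sub_nonneg.2 (hm l (Finset.mem_univ l)))).1 h3 j (Finset.mem_univ j)
    rcases mul_eq_zero.1 h4 with h | h
    · exact absurd h hk.ne'
    · linarith
  rw [key x, key y]

open Matrix in
/-- The Poisson equation of a finite chain whose harmonic functions are constant is solvable for
every function that is centred under an invariant distribution. -/
lemma IsInvariantDistribution.exists_poisson {X : Type*} [Fintype X]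
    {P : Matrix X X ℝ} {q : X → ℝ} (hq : IsInvariantDistribution P q)
    (hP : ∀ h : X → ℝ, P *ᵥ h = h → ∀ x y, h x = h y) {f : X → ℝ} (hf : ∑ x, q x * f x = 0) :
    ∃ V : X → ℝ, ∀ x, V x - (P *ᵥ V) x = f x := by
  classical
  -- Dimension count: invariance puts the range of `L = I - P` inside `ker Q`, which has codimension
  -- one, and `ker L` is at most the constants, so the two coincide.
  let L : (X → ℝ) →ₗ[ℝ] (X → ℝ) := LinearMap.id - P.mulVecLin
  let Q : (X → ℝ) →ₗ[ℝ] ℝ := ∑ x, q x • LinearMap.proj x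
  have hQ : ∀ g, Q g = ∑ x, q x * g x := fun g => by simp [Q]
  have hL : ∀ g, L g = g - P *ᵥ g := fun g => by simp [L]
  have hle : LinearMap.range L ≤ LinearMap.ker Q := by
    rintro _ ⟨g, rfl⟩
    rw [LinearMap.mem_ker, hQ, hL]
    have : ∑ x, q x * (P *ᵥ g) x = ∑ x, q x * g x := by
      simp only [mulVec, dotProduct, Finset.mul_sum]
      rw [Finset.sum_comm]
      refine Finset.sum_congr rfl fun y _ => ?_
      rw [← hq.invariant y, Finset.sum_mul]
      exact Finset.sum_congr rfl fun x _ => by ring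
    simp [mul_sub, Finset.sum_sub_distrib, this]
  have hker : Module.finrank ℝ (LinearMap.ker L) ≤ 1 := by
    refine (Submodule.finrank_mono (t := Submodule.span ℝ {fun _ => (1 : ℝ)}) ?_).trans
      ((finrank_span_le_card _).trans (by simp))
    intro g hg
    rw [LinearMap.mem_ker, hL, sub_eq_zero] at hg
    rw [Submodule.mem_span_singleton]
    rcases isEmpty_or_nonempty X with hX | ⟨⟨x⟩⟩
    · exact ⟨0, Subsingleton.elim _ _⟩
    · exact ⟨g x, funext fun y => by simpa using hP g hg.symm x y⟩
  have hsurj : Module.finrank ℝ (LinearMap.range Q) = 1 := by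
    have : LinearMap.range Q = ⊤ := by
      refine LinearMap.range_eq_top.2 fun t => ⟨fun _ => t, ?_⟩
      rw [hQ, ← Finset.sum_mul, hq.sum_eq_one, one_mul]
    rw [this, finrank_top, Module.finrank_self]
  have e1 := L.finrank_range_add_finrank_ker
  have e2 := Q.finrank_range_add_finrank_ker
  have heq := Submodule.eq_of_le_of_finrank_le hle (by omega)
  have hmem : f ∈ LinearMap.range L := by
    rw [heq, LinearMap.mem_ker, hQ, hf]
  obtain ⟨V, hV⟩ := hmem
  exact ⟨V, fun x => by rw [← hV, hL]; rfl⟩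

/-! ### The window chain -/

namespace FiniteMDP

variable {S A : Type*} [Fintype S] [Fintype A] (M : FiniteMDP S A) (b : RandPolicy S A)

lemma stateActionMatrix_sum (x : S × A) : ∑ x', M.stateActionMatrix b x x' = 1 := by
  simp [stateActionMatrix, Fintype.sum_prod_type, ← Finset.mul_sum, b.prob_sum, M.trans_sum]

/-- The window obtained from `y` by dropping the first pair and appending `x`. -/
def pushWindow {S A : Type*} {N : ℕ} (y : Window S A N) (x : S × A) : Window S A N :=
  fun i => if h : (i : ℕ) + 1 < N + 1 then y ⟨i + 1, h⟩ else x

-- From `y` only the windows `pushWindow y x` can be reached, and `x` is recovered as the last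
-- entry.
open Matrix in
lemma windowMatrix_mulVec {N : ℕ} (h : Window S A N → ℝ) (y : Window S A N) :
    (M.windowMatrix b N *ᵥ h) y =
      ∑ x, M.stateActionMatrix b (y (Fin.last N)) x * h (pushWindow y x) := by
  classical
  rw [mulVec, dotProduct]
  symm
  refine Fintype.sum_of_injective (pushWindow y) ?_ _ _ ?_ ?_
  · intro x x' hx
    simpa [pushWindow] using congrFun hx (Fin.last N)
  · intro z hz
    have : ¬ ∀ i : Fin N, z i.castSucc = y i.succ := by
      intro hc
      refine hz ⟨z (Fin.last N), funext fun i => ?_⟩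
      induction i using Fin.lastCases with
      | last => simp [pushWindow]
      | cast i =>
        rw [hc i]
        simp [pushWindow, Fin.succ]
    simp [windowMatrix, this]
  · intro x
    have h1 : ∀ i : Fin N, pushWindow y x i.castSucc = y i.succ := fun i => by
      simp [pushWindow, Fin.succ]
    have h2 : pushWindow y x (Fin.last N) = x := by simp [pushWindow]
    simp [windowMatrix, h1, h2]

open Matrix in
/-- Harmonic functions of the window chain are constant. -/
lemma eq_of_windowMatrix_mulVec_eq [DecidableEq S] [DecidableEq A]
    (hirr : (M.stateActionMatrix b).IsIrreducible) {N : ℕ} {h : Window S A N → ℝ}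
    (hh : M.windowMatrix b N *ᵥ h = h) (y y' : Window S A N) : h y = h y' := by
  have hstep : ∀ y, h y = ∑ x, M.stateActionMatrix b (y (Fin.last N)) x * h (pushWindow y x) :=
    fun y => by rw [← M.windowMatrix_mulVec b, hh]
  -- Each push shifts agreement one index to the left, so after enough pushes only the last pair of
  -- the original window has mattered. Hence `h` descends to a harmonic function of the state-action
  -- chain.
  have hdep : ∀ m : ℕ, m ≤ N → ∀ y y' : Window S A N,
      (∀ i : Fin (N + 1), m ≤ (i : ℕ) → y i = y' i) → h y = h y' := by
    intro m
    induction m with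
    | zero => intro _ y y' hy; rw [funext fun i => hy i (Nat.zero_le _)]
    | succ m ih =>
      intro hm y y' hy
      rw [hstep y, hstep y', hy (Fin.last N) (by simpa using hm)]
      refine Finset.sum_congr rfl fun x _ => ?_
      rw [ih (by omega) (pushWindow y x) (pushWindow y' x) fun i hi => ?_]
      unfold pushWindow
      split_ifs with hlt
      · exact hy ⟨i + 1, hlt⟩ (by simpa using hi)
      · rfl
  have hlast : ∀ y y' : Window S A N, y (Fin.last N) = y' (Fin.last N) → h y = h y' := by
    intro y y' hyy
    refine hdep N le_rfl y y' fun i hi => ?_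
    have : i = Fin.last N := Fin.ext (by simpa using le_antisymm (Nat.lt_succ_iff.1 i.2) hi)
    rw [this, hyy]
  let u : S × A → ℝ := fun x => h fun _ => x
  have hu : M.stateActionMatrix b *ᵥ u = u := by
    ext x
    change ∑ x', M.stateActionMatrix b x x' * u x' = h fun _ => x
    rw [hstep]
    refine Finset.sum_congr rfl fun x' _ => ?_
    rw [hlast (pushWindow _ x') (fun _ => x') (by simp [pushWindow])]
  rw [hlast y (fun _ => y (Fin.last N)) rfl, hlast y' (fun _ => y' (Fin.last N)) rfl]
  exact hirr.eq_of_mulVec_eq (M.stateActionMatrix_sum b) hu _ _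

end FiniteMDP

/-! ### Martingale convergence over finite histories -/

lemma integrable_and_integral_comp_finite {Ω : Type*} [MeasurableSpace Ω] {μ : Measure Ω}
    [IsFiniteMeasure μ] {κ : Type*} [Fintype κ] {Z : Ω → κ}
    (hZ : ∀ z, MeasurableSet {ω | Z ω = z}) (φ : κ → ℝ) :
    Integrable (fun ω => φ (Z ω)) μ ∧ ∫ ω, φ (Z ω) ∂μ = ∑ z, μ.real {ω | Z ω = z} * φ z := by
  let : MeasurableSpace κ := ⊤
  have hm : Measurable Z := measurable_to_countable' hZ
  have hi : Integrable φ (μ.map Z) := Integrable.of_finite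
  refine ⟨hi.comp_measurable hm, ?_⟩
  rw [← integral_map (f := φ) hm.aemeasurable (measurable_from_top.aestronglyMeasurable),
    integral_fintype hi]
  refine Finset.sum_congr rfl fun z _ => ?_
  rw [map_measureReal_apply hm (measurableSet_singleton z), smul_eq_mul]
  rfl

/-- A sum of increments that are centred given the finite past of a finite chain converges almost
surely as soon as the increments have square summable bounds. -/
lemma ae_exists_tendsto_sum_of_centred {Ω : Type*} [MeasurableSpace Ω] {μ : Measure Ω}
    [IsProbabilityMeasure μ] {T : Type*} [Fintype T] {K : Matrix T T ℝ} {X : ℕ → Ω → T}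
    (hX : ∀ t x, MeasurableSet {ω | X t ω = x})
    (hK : ∀ (t : ℕ) (h : ℕ → T) (x : T),
      μ.real {ω | (∀ i ≤ t, X i ω = h i) ∧ X (t + 1) ω = x} =
        μ.real {ω | ∀ i ≤ t, X i ω = h i} * K (h t) x)
    (F : ∀ t, (Fin (t + 1) → T) → T → ℝ)
    (hF : ∀ t h, ∑ x, K (h (Fin.last t)) x * F t h x = 0)
    {C : ℕ → ℝ} (hC : ∀ t h x, |F t h x| ≤ C t) (hsum : Summable fun t => C t ^ 2) :
    ∀ᵐ ω ∂μ, ∃ l, Tendsto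
      (fun n => ∑ t ∈ Finset.range n, F t (fun i => X i ω) (X (t + 1) ω)) atTop (𝓝 l) := by
  classical
  let H : ∀ t, Ω → (Fin (t + 1) → T) := fun t ω i => X i ω
  let D : ℕ → Ω → ℝ := fun t ω => F t (H t ω) (X (t + 1) ω)
  let Mg : ℕ → Ω → ℝ := fun n ω => ∑ t ∈ Finset.range n, D t ω
  have hH : ∀ t h, MeasurableSet {ω | H t ω = h} := by
    intro t h
    have : {ω | H t ω = h} = ⋂ i : Fin (t + 1), {ω | X i ω = h i} := by
      ext ω; simp [H, funext_iff]
    rw [this]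
    exact MeasurableSet.iInter fun i => hX _ _
  have hZ : ∀ t (z : (Fin (t + 1) → T) × T), MeasurableSet {ω | (H t ω, X (t + 1) ω) = z} := by
    rintro t ⟨h, x⟩
    have : {ω | (H t ω, X (t + 1) ω) = (h, x)} = {ω | H t ω = h} ∩ {ω | X (t + 1) ω = x} := by
      ext ω; simp
    rw [this]
    exact (hH t h).inter (hX _ _)
  have hlaw : ∀ t h x, μ.real {ω | (H t ω, X (t + 1) ω) = (h, x)} =
      μ.real {ω | H t ω = h} * K (h (Fin.last t)) x := by
    intro t h x
    -- `Fin.ofNat` extends a finite history to all of `ℕ`; indices up to `t` are unchanged by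
    -- reduction modulo `t + 1`.
    have := hK t (fun i => h (Fin.ofNat (t + 1) i)) x
    have e : ∀ ω, (∀ i ≤ t, X i ω = h (Fin.ofNat (t + 1) i)) ↔ H t ω = h := by
      intro ω
      constructor
      · intro hi
        ext1 i
        have := hi i (Nat.lt_succ_iff.1 i.2)
        rwa [Fin.ofNat_val_eq_self] at this
      · rintro rfl i hi
        simp [H, Nat.mod_eq_of_lt (Nat.lt_succ_iff.2 hi)]
    simp only [e] at this
    have e2 : Fin.ofNat (t + 1) t = Fin.last t := by ext; simp
    rw [e2] at this
    rw [← this]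
    congr 1
    ext ω; simp
  -- Used twice: it kills the cross term in the `L²` bound, and with `g` an indicator it is the
  -- martingale property.
  have horth : ∀ t (g : (Fin (t + 1) → T) → ℝ), ∫ ω, g (H t ω) * D t ω ∂μ = 0 := by
    intro t g
    rw [(integrable_and_integral_comp_finite (μ := μ) (hZ t) fun z => g z.1 * F t z.1 z.2).2,
      Fintype.sum_prod_type]
    refine Finset.sum_eq_zero fun h _ => ?_
    have : ∀ x, μ.real {ω | (H t ω, X (t + 1) ω) = (h, x)} * (g h * F t h x) =
        μ.real {ω | H t ω = h} * g h * (K (h (Fin.last t)) x * F t h x) := by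
      intro x; rw [hlaw]; ring
    simp only [this, ← Finset.mul_sum, hF, mul_zero]
  have hMg : ∀ n, ∃ G : (Fin (n + 1) → T) → ℝ, ∀ ω, Mg n ω = G (H n ω) := by
    intro n
    refine ⟨fun h => ∑ t ∈ Finset.range n,
      F t (fun i => h (Fin.ofNat (n + 1) i)) (h (Fin.ofNat (n + 1) (t + 1))), fun ω => ?_⟩
    refine Finset.sum_congr rfl fun t ht => ?_
    have ht := Finset.mem_range.1 ht
    have h1 : ∀ i : Fin (t + 1), (i : ℕ) % (n + 1) = i := fun i => Nat.mod_eq_of_lt (by omega)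
    simp [D, H, h1, Nat.mod_eq_of_lt (Nat.succ_lt_succ ht)]
  choose G hG using hMg
  have hint : ∀ n, Integrable (Mg n) μ := fun n => by
    rw [funext (hG n)]; exact (integrable_and_integral_comp_finite (hH n) _).1
  have hintD : ∀ n, Integrable (D n) μ := fun n =>
    (integrable_and_integral_comp_finite (hZ n) fun z => F n z.1 z.2).1
  have hint2 : ∀ n, Integrable (fun ω => Mg n ω ^ 2) μ := fun n => by
    simp only [hG n]; exact (integrable_and_integral_comp_finite (hH n) fun h => G n h ^ 2).1
  have hintD2 : ∀ n, Integrable (fun ω => D n ω ^ 2) μ := fun n =>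
    (integrable_and_integral_comp_finite (hZ n) fun z => F n z.1 z.2 ^ 2).1
  have hintMD : ∀ n, Integrable (fun ω => G n (H n ω) * D n ω) μ := fun n =>
    (integrable_and_integral_comp_finite (hZ n) fun z => G n z.1 * F n z.1 z.2).1
  have hL2 : ∀ n, ∫ ω, Mg n ω ^ 2 ∂μ ≤ ∑ t ∈ Finset.range n, C t ^ 2 := by
    intro n
    induction n with
    | zero => simp [Mg]
    | succ n ih =>
      have e : ∀ ω, Mg (n + 1) ω ^ 2 = Mg n ω ^ 2 + 2 * (G n (H n ω) * D n ω) + D n ω ^ 2 := by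
        intro ω
        rw [← hG n ω]
        simp only [Mg, Finset.sum_range_succ]
        ring
      have hD : ∫ ω, D n ω ^ 2 ∂μ ≤ C n ^ 2 := by
        have := integral_mono (hintD2 n) (integrable_const (C n ^ 2)) fun ω =>
          sq_le_sq.2 ((hC n (H n ω) (X (n + 1) ω)).trans (le_abs_self _))
        simpa using this
      simp only [e]
      have hi : Integrable (fun ω => Mg n ω ^ 2 + 2 * (G n (H n ω) * D n ω)) μ :=
        (hint2 n).add ((hintMD n).const_mul 2)
      rw [integral_add hi (hintD2 n),
        integral_add (hint2 n) ((hintMD n).const_mul 2), integral_const_mul, horth,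
        Finset.sum_range_succ]
      linarith
  let ℱ : Filtration ℕ ‹MeasurableSpace Ω› :=
    { seq := fun n => MeasurableSpace.comap (H n) ⊤
      mono' := by
        intro m n hmn
        rintro _ ⟨B, -, rfl⟩
        refine ⟨{h | (fun i : Fin (m + 1) => h (Fin.ofNat (n + 1) i)) ∈ B}, trivial, ?_⟩
        ext ω
        have h1 : ∀ i : Fin (m + 1), (i : ℕ) % (n + 1) = i :=
          fun i => Nat.mod_eq_of_lt (by omega)
        simp [H, h1]
      le' := by
        rintro n _ ⟨B, -, rfl⟩
        have : H n ⁻¹' B = ⋃ h ∈ B, {ω | H n ω = h} := by ext ω; simp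
        rw [this]
        exact MeasurableSet.biUnion (Set.to_countable B) fun h _ => hH n h }
  have hmart : Martingale Mg ℱ μ := by
    refine martingale_of_setIntegral_eq_succ (fun n => ?_) hint ?_
    · let : MeasurableSpace (Fin (n + 1) → T) := ⊤
      have h1 : Measurable[ℱ n] (H n) := comap_measurable _
      have h2 : Measurable[ℱ n] (Mg n) := by
        rw [funext (hG n)]; exact measurable_from_top.comp h1
      exact h2.stronglyMeasurable
    · intro n s hs
      have hs' := ℱ.le n s hs
      obtain ⟨B, -, rfl⟩ := hs
      have e : ∀ ω, Mg (n + 1) ω = Mg n ω + D n ω := fun ω => Finset.sum_range_succ _ _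
      simp only [e]
      rw [integral_add (hint n).integrableOn (hintD n).integrableOn, left_eq_add,
        ← integral_indicator hs', ← horth n (B.indicator 1)]
      congr 1 with ω
      by_cases hω : H n ω ∈ B <;> simp [Set.indicator, hω]
  -- The `L¹` bound comes from the `L²` bound through `|x| ≤ 1 + x ^ 2`.
  refine hmart.submartingale.exists_ae_tendsto_of_bdd
    (R := (1 + ∑' t, C t ^ 2).toNNReal) fun n => ?_
  rw [eLpNorm_one_eq_lintegral_enorm, ← ofReal_integral_norm_eq_lintegral_enorm (hint n)]
  refine ENNReal.ofReal_le_ofReal ?_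
  calc ∫ ω, ‖Mg n ω‖ ∂μ ≤ ∫ ω, (1 + Mg n ω ^ 2) ∂μ := by
        refine integral_mono (hint n).norm ((integrable_const _).add (hint2 n)) fun ω => ?_
        rw [Real.norm_eq_abs]
        change |Mg n ω| ≤ 1 + Mg n ω ^ 2
        nlinarith [sq_nonneg (|Mg n ω| - 1), sq_abs (Mg n ω), abs_nonneg (Mg n ω)]
    _ = 1 + ∫ ω, Mg n ω ^ 2 ∂μ := by
        rw [integral_add (integrable_const _) (hint2 n)]; simp
    _ ≤ 1 + ∑' t, C t ^ 2 := by
        gcongr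
        exact (hL2 n).trans (hsum.sum_le_tsum _ fun t _ => sq_nonneg _)

/-! ### Weighted window sums along a trajectory -/

namespace FiniteMDP

variable {S A : Type*} [Fintype S] [Fintype A] {M : FiniteMDP S A} {b : RandPolicy S A}
  {Ω : Type*} [MeasurableSpace Ω] {μ : Measure Ω} {St : ℕ → Ω → S} {Act : ℕ → Ω → A}

lemma IsTrajectory.measurableSet_pair (h : M.IsTrajectory b μ St Act) (t : ℕ) (x : S × A) :
    MeasurableSet {ω | (St t ω, Act t ω) = x} := by
  have : {ω | (St t ω, Act t ω) = x} = {ω | St t ω = x.1} ∩ {ω | Act t ω = x.2} := by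
    ext ω; simp [Prod.ext_iff]
  rw [this]
  exact (h.measurable_state t _).inter (h.measurable_action t _)

/-- The state-action process of a trajectory is a Markov chain. -/
lemma IsTrajectory.pair_law (h : M.IsTrajectory b μ St Act) (t : ℕ) (p : ℕ → S × A) (x : S × A) :
    μ.real {ω | (∀ i ≤ t, (St i ω, Act i ω) = p i) ∧ (St (t + 1) ω, Act (t + 1) ω) = x} =
      μ.real {ω | ∀ i ≤ t, (St i ω, Act i ω) = p i} * M.stateActionMatrix b (p t) x := by
  have h1 := h.action_law (t + 1) p x.1 x.2
  have h2 := h.state_law t p x.1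
  simp only [Nat.lt_succ_iff] at h1
  rw [h2] at h1
  rw [stateActionMatrix, ← mul_assoc, ← h1]
  congr 1
  ext ω
  simp [Prod.ext_iff]

lemma dataWindow_succ {S A Ω : Type*} (N : ℕ) (St : ℕ → Ω → S) (Act : ℕ → Ω → A) (k : ℕ) (ω : Ω) :
    dataWindow N St Act (k + 1) ω =
      pushWindow (dataWindow N St Act k ω) (St (N + k + 1) ω, Act (N + k + 1) ω) := by
  funext i
  unfold pushWindow dataWindow
  split_ifs with hi
  · have : k + 1 + (i : ℕ) = k + ((i : ℕ) + 1) := by ring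
    simp [this]
  · have : k + 1 + (i : ℕ) = N + k + 1 := by omega
    simp [this]

open Matrix in
/-- Weighted sums of a centred window function along a trajectory converge almost surely when the
weights `(k + 1) ^ (-s)` are square summable. -/
lemma IsTrajectory.ae_exists_tendsto_sum [IsProbabilityMeasure μ] [DecidableEq S] [DecidableEq A]
    (h : M.IsTrajectory b μ St Act) (hirr : (M.stateActionMatrix b).IsIrreducible) {N : ℕ}
    {q : Window S A N → ℝ} (hq : IsInvariantDistribution (M.windowMatrix b N) q)
    {f : Window S A N → ℝ} (hf : ∑ y, q y * f y = 0) {s : ℝ} (hs : 1 / 2 < s) :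
    ∀ᵐ ω ∂μ, ∃ l, Tendsto (fun n => ∑ k ∈ Finset.range n,
      ((k : ℝ) + 1) ^ (-s) * f (dataWindow N St Act k ω)) atTop (𝓝 l) := by
  obtain ⟨V, hV⟩ := hq.exists_poisson
    (fun g hg => M.eq_of_windowMatrix_mulVec_eq b hirr hg) hf
  let w : ℕ → Ω → ℝ := fun k ω => V (dataWindow N St Act k ω)
  let a : ℕ → ℝ := fun k => ((k : ℝ) + 1) ^ (-s)
  let K := M.stateActionMatrix b
  -- By the Poisson equation, `f(Y k) = g + (V(Y k) - V(Y (k+1)))`, where `g` is the innovation of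
  -- `V` in passing to `Y (k+1)`.
  let g : Window S A N → S × A → ℝ := fun y x =>
    V (pushWindow y x) - ∑ x', K (y (Fin.last N)) x' * V (pushWindow y x')
  have hg : ∀ y, ∑ x, K (y (Fin.last N)) x * g y x = 0 := by
    intro y
    simp only [g, mul_sub, Finset.sum_sub_distrib, ← Finset.sum_mul]
    rw [M.stateActionMatrix_sum b, one_mul, sub_self]
  obtain ⟨B, hB⟩ : ∃ B, ∀ z : Window S A N × (S × A), |g z.1 z.2| ≤ B := by
    obtain ⟨B, hB⟩ := (Set.finite_range fun z : Window S A N × (S × A) => |g z.1 z.2|).bddAbove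
    exact ⟨B, fun z => hB ⟨z, rfl⟩⟩
  -- Window `k` is complete only at time `t = N + k`, hence the shift `t - N` and the zero
  -- increments for `t < N`.
  let win : ∀ t, (Fin (t + 1) → S × A) → Window S A N :=
    fun t p i => p (Fin.ofNat (t + 1) (t - N + i))
  let F : ∀ t, (Fin (t + 1) → S × A) → S × A → ℝ := fun t p x =>
    if N ≤ t then a (t - N) * g (win t p) x else 0
  let C : ℕ → ℝ := fun t => if N ≤ t then a (t - N) * B else 0
  have ha0 : ∀ k, 0 ≤ a k := fun k => by positivity
  have hasq : Summable fun k => a k ^ 2 := by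
    have h1 : Summable fun k : ℕ => (k : ℝ) ^ (-(2 * s)) :=
      Real.summable_nat_rpow.2 (by linarith)
    refine ((summable_nat_add_iff 1).2 h1).congr fun k => ?_
    rw [← Real.rpow_mul_natCast (by positivity)]
    push_cast
    congr 1
    ring
  have hmart : ∀ᵐ ω ∂μ, ∃ l, Tendsto (fun n => ∑ t ∈ Finset.range n,
      F t (fun i => (St i ω, Act i ω)) (St (t + 1) ω, Act (t + 1) ω)) atTop (𝓝 l) := by
    refine ae_exists_tendsto_sum_of_centred (X := fun t ω => (St t ω, Act t ω))
      h.measurableSet_pair h.pair_law F ?_ (C := C) ?_ ?_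
    · intro t p
      by_cases ht : N ≤ t
      · have hl : win t p (Fin.last N) = p (Fin.last t) := by
          simp only [win, Fin.val_last, Nat.sub_add_cancel ht]
          congr 1; ext; simp
        have := hg (win t p)
        rw [hl] at this
        calc _ = a (t - N) * ∑ x, K (p (Fin.last t)) x * g (win t p) x := by
              rw [Finset.mul_sum]
              refine Finset.sum_congr rfl fun x _ => ?_
              simp only [F, if_pos ht]
              ring
          _ = 0 := by rw [this, mul_zero]
      · simp [F, ht]
    · intro t p x
      by_cases ht : N ≤ t
      · simp only [F, C, if_pos ht, abs_mul, abs_of_nonneg (ha0 _)]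
        exact mul_le_mul_of_nonneg_left (hB (_, _)) (ha0 _)
      · simp [F, C, ht]
    · rw [← summable_nat_add_iff N]
      refine (hasq.mul_right (B ^ 2)).congr fun k => ?_
      simp [C, mul_pow]
  obtain ⟨B', hB'⟩ : ∃ B, ∀ y, |V y| ≤ B := by
    obtain ⟨B, hB⟩ := (Set.finite_range fun y => |V y|).bddAbove
    exact ⟨B, fun z => hB ⟨z, rfl⟩⟩
  filter_upwards [hmart] with ω ⟨l, hl⟩
  have hanti : Antitone a := fun m n hmn =>
    Real.rpow_le_rpow_of_nonpos (by positivity) (by gcongr) (by linarith)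
  have hatend : Tendsto a atTop (𝓝 0) :=
    (tendsto_rpow_neg_atTop (by linarith)).comp
      (tendsto_atTop_add_const_right _ 1 tendsto_natCast_atTop_atTop)
  -- Dirichlet's test: the weights decrease to zero and the telescoping sums stay bounded.
  obtain ⟨l', hl'⟩ := cauchySeq_tendsto_of_complete
    (hanti.cauchySeq_series_mul_of_tendsto_zero_of_bounded hatend
      (z := fun k => w k ω - w (k + 1) ω) (b := 2 * B') fun n => by
        rw [Finset.sum_range_sub', Real.norm_eq_abs]
        refine (abs_sub _ _).trans ?_
        have := hB' (dataWindow N St Act 0 ω)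
        have := hB' (dataWindow N St Act n ω)
        simp only [w]
        linarith)
  have hl2 := hl.comp (tendsto_add_atTop_nat N)
  refine ⟨l + l', (hl2.add hl').congr fun n => ?_⟩
  simp only [Function.comp]
  rw [add_comm n N, Finset.sum_range_add]
  have h0 : ∑ t ∈ Finset.range N,
      F t (fun i => (St i ω, Act i ω)) (St (t + 1) ω, Act (t + 1) ω) = 0 := by
    refine Finset.sum_eq_zero fun t ht => ?_
    simp [F, Finset.mem_range.1 ht]
  rw [h0, zero_add, ← Finset.sum_add_distrib]
  refine Finset.sum_congr rfl fun k _ => ?_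
  have hwin : win (N + k) (fun i => (St i ω, Act i ω)) = dataWindow N St Act k ω := by
    funext i
    have h1 : k + (i : ℕ) < N + k + 1 := by omega
    simp [win, dataWindow, Nat.mod_eq_of_lt h1]
  have hg' : g (dataWindow N St Act k ω) (St (N + k + 1) ω, Act (N + k + 1) ω) =
      w (k + 1) ω - (w k ω - f (dataWindow N St Act k ω)) := by
    rw [← hV (dataWindow N St Act k ω), M.windowMatrix_mulVec b]
    simp only [g, w, dataWindow_succ, K]
    ring
  simp only [F, if_pos (Nat.le_add_right N k), Nat.add_sub_cancel_left, hwin, hg', smul_eq_mul]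
  ring

end FiniteMDP

/-! ### Deterministic estimates: tails and recursions -/

lemma tendsto_nat_succ_rpow_neg {s : ℝ} (hs : 0 < s) :
    Tendsto (fun n : ℕ => ((n : ℝ) + 1) ^ (-s)) atTop (𝓝 0) :=
  (tendsto_rpow_neg_atTop hs).comp
    (tendsto_atTop_add_const_right _ 1 tendsto_natCast_atTop_atTop)

lemma antitone_nat_succ_rpow_neg {s : ℝ} (hs : 0 ≤ s) :
    Antitone fun n : ℕ => ((n : ℝ) + 1) ^ (-s) := fun m n hmn =>
  Real.rpow_le_rpow_of_nonpos (by positivity) (by gcongr) (by linarith)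

/-- If `∑ u k` converges and `c` decreases to zero, then the tails of `∑ c k • u k` are `O(c n)`. -/
lemma exists_tail_of_tendsto_sum {E : Type*} [NormedAddCommGroup E] [NormedSpace ℝ E]
    [CompleteSpace E] {u : ℕ → E} {c : ℕ → ℝ} (hc : Antitone c) (hc0 : Tendsto c atTop (𝓝 0))
    {l : E} (hu : Tendsto (fun n => ∑ k ∈ Finset.range n, u k) atTop (𝓝 l)) :
    ∃ R : ℕ → E, (∀ n, R (n + 1) = R n - c n • u n) ∧ ∃ C, 0 ≤ C ∧ ∀ n, ‖R n‖ ≤ C * c n := by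
  have hcnn : ∀ n, 0 ≤ c n := hc.le_of_tendsto hc0
  obtain ⟨B, hB⟩ := (hu.sub_const l).norm.bddAbove_range
  have hB : ∀ n, ‖∑ k ∈ Finset.range n, u k - l‖ ≤ B := fun n => hB ⟨n, rfl⟩
  have hB0 : 0 ≤ B := (norm_nonneg _).trans (hB 0)
  let T : ℕ → E := fun n => ∑ k ∈ Finset.range n, u k - l
  let Z : ℕ → E := fun n => ∑ k ∈ Finset.range n, c k • u k
  -- Abel summation: `Z - c • T` has increments `(c m - c (m+1)) • T (m+1)`, whose norm bounds
  -- telescope.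
  have hZ : ∀ n m, n ≤ m → ‖(Z m - c m • T m) - (Z n - c n • T n)‖ ≤ B * (c n - c m) := by
    intro n m hnm
    induction m, hnm using Nat.le_induction with
    | base => simp
    | succ m hnm ih =>
      have e : (Z (m + 1) - c (m + 1) • T (m + 1)) - (Z n - c n • T n) =
          ((Z m - c m • T m) - (Z n - c n • T n)) + (c m - c (m + 1)) • T (m + 1) := by
        simp only [Z, T, Finset.sum_range_succ]
        module
      rw [e]
      refine (norm_add_le _ _).trans ?_
      rw [norm_smul, Real.norm_eq_abs, abs_of_nonneg (sub_nonneg.2 (hc (Nat.le_succ m)))]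
      have := mul_le_mul_of_nonneg_left (hB (m + 1)) (sub_nonneg.2 (hc (Nat.le_succ m)))
      simp only [T] at *
      nlinarith
  have hZ2 : ∀ n m, n ≤ m → ‖Z m - Z n‖ ≤ 2 * B * c n := by
    intro n m hnm
    have e : Z m - Z n = ((Z m - c m • T m) - (Z n - c n • T n)) + (c m • T m - c n • T n) := by
      module
    have h1 : ∀ k, ‖c k • T k‖ ≤ c k * B := fun k => by
      rw [norm_smul, Real.norm_eq_abs, abs_of_nonneg (hcnn k)]
      exact mul_le_mul_of_nonneg_left (hB k) (hcnn k)
    rw [e]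
    refine (norm_add_le _ _).trans ?_
    have h2 := norm_sub_le (c m • T m) (c n • T n)
    have h3 := hZ n m hnm
    have h4 := h1 m
    have h5 := h1 n
    linarith
  have hcau : CauchySeq Z := by
    refine cauchySeq_of_le_tendsto_0' (fun n => 2 * B * c n) (fun n m hnm => ?_)
      (by simpa using hc0.const_mul (2 * B))
    rw [dist_comm, dist_eq_norm]
    exact hZ2 n m hnm
  obtain ⟨z, hz⟩ := cauchySeq_tendsto_of_complete hcau
  refine ⟨fun n => z - Z n, fun n => ?_, 2 * B, by positivity, fun n => ?_⟩
  · simp only [Z, Finset.sum_range_succ]; abel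
  · exact le_of_tendsto (hz.sub_const (Z n)).norm
      ((eventually_ge_atTop n).mono fun m hm => hZ2 n m hm)

/-- Decay of a nonnegative sequence that contracts at rate `lam * α n` up to errors of relative
size `(n + 1) ^ (-s)`. -/
lemma exists_eventually_le_of_recursion {z α : ℕ → ℝ} {lam C s r δ : ℝ} (hz : ∀ n, 0 ≤ z n)
    (hα : ∀ n, 0 < α n) (hα0 : Tendsto α atTop (𝓝 0)) (hC : 0 ≤ C) (hr : 0 < r) (hr1 : r ≤ 1)
    (hrs : r ≤ s) (hδ : 0 < δ)
    (hrate : ∀ᶠ n : ℕ in atTop, r / ((n : ℝ) + 1) ≤ (lam - 2 * δ) * α n)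
    (hrec : ∀ᶠ n : ℕ in atTop, z (n + 1) ≤
      (1 - lam * α n) * z n + α n * (C * ((n : ℝ) + 1) ^ (-s) * (z n + 1))) :
    ∃ D, 0 ≤ D ∧ ∀ᶠ n : ℕ in atTop, z n ≤ D * ((n : ℝ) + 1) ^ (-r) := by
  let v : ℕ → ℝ := fun n => ((n : ℝ) + 1) ^ r * z n
  -- Of the margin `2 * δ`, one `δ` absorbs the error proportional to `z n`; the other survives the
  -- growth factor `1 + r / (n + 1)` of the weight, which is Bernoulli's bound for `r ≤ 1`.
  have hstep : ∀ᶠ n : ℕ in atTop, v (n + 1) ≤ (1 - δ * α n) * v n + 2 * C * α n := by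
    have hθ : ∀ᶠ n : ℕ in atTop, C * ((n : ℝ) + 1) ^ (-s) < δ := by
      have := (tendsto_nat_succ_rpow_neg (hr.trans_le hrs)).const_mul C
      rw [mul_zero] at this
      exact this.eventually_lt_const hδ
    filter_upwards [hrate, hrec, hθ] with n h1 h2 h3
    have hn : (0 : ℝ) < (n : ℝ) + 1 := by positivity
    have hpow : ((n : ℝ) + 1 + 1) ^ r ≤ ((n : ℝ) + 1) ^ r * (1 + r / ((n : ℝ) + 1)) := by
      have e : (n : ℝ) + 1 + 1 = ((n : ℝ) + 1) * (1 + 1 / ((n : ℝ) + 1)) := by field_simp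
      rw [e, Real.mul_rpow hn.le (by positivity)]
      refine mul_le_mul_of_nonneg_left ?_ (by positivity)
      have := rpow_one_add_le_one_add_mul_self (s := 1 / ((n : ℝ) + 1))
        (by linarith [show 0 ≤ 1 / ((n : ℝ) + 1) by positivity]) hr.le hr1
      calc _ ≤ 1 + r * (1 / ((n : ℝ) + 1)) := this
        _ = _ := by ring
    have hθr : ((n : ℝ) + 1) ^ r * ((n : ℝ) + 1) ^ (-s) ≤ 1 := by
      rw [← Real.rpow_add hn]
      exact Real.rpow_le_one_of_one_le_of_nonpos (by linarith [n.cast_nonneg (α := ℝ)])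
        (by linarith)
    set P := ((n : ℝ) + 1) ^ r
    set θ := ((n : ℝ) + 1) ^ (-s)
    set τ := r / ((n : ℝ) + 1)
    have hP : 0 < P := by positivity
    have hτ : 0 < τ := by positivity
    have hτ1 : τ ≤ 1 := by
      rw [div_le_one hn]; linarith [n.cast_nonneg (α := ℝ)]
    have hαn := hα n
    have hzn := hz n
    have hvn : 0 ≤ v n := by positivity
    have hlam : 0 < lam - 2 * δ := by
      by_contra hcon
      nlinarith [mul_nonneg (sub_nonneg.2 (not_lt.1 hcon)) hαn.le]
    have hz1 : z (n + 1) ≤ (1 - (lam - δ) * α n) * z n + α n * (C * θ) := by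
      have : α n * (C * θ * (z n + 1)) ≤ α n * (δ * z n + C * θ) := by
        refine mul_le_mul_of_nonneg_left ?_ hαn.le
        nlinarith
      nlinarith
    calc v (n + 1) = ((n : ℝ) + 1 + 1) ^ r * z (n + 1) := by simp [v]
      _ ≤ P * (1 + τ) * z (n + 1) := mul_le_mul_of_nonneg_right hpow (hz _)
      _ ≤ P * (1 + τ) * ((1 - (lam - δ) * α n) * z n + α n * (C * θ)) :=
        mul_le_mul_of_nonneg_left hz1 (by positivity)
      _ = ((1 + τ) * (1 - (lam - δ) * α n)) * v n + (1 + τ) * C * α n * (P * θ) := by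
        simp only [v, P]; ring
      _ ≤ (1 - δ * α n) * v n + 2 * C * α n := by
        refine add_le_add (mul_le_mul_of_nonneg_right ?_ hvn) ?_
        · nlinarith [mul_pos hτ (mul_pos (by linarith : 0 < lam - δ) hαn)]
        · calc (1 + τ) * C * α n * (P * θ) ≤ (1 + τ) * C * α n * 1 :=
                mul_le_mul_of_nonneg_left hθr (by positivity)
            _ ≤ 2 * C * α n := by
                rw [mul_one]; gcongr; linarith
  have hsmall : ∀ᶠ n : ℕ in atTop, δ * α n < 1 := by
    have := hα0.const_mul δ
    rw [mul_zero] at this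
    exact this.eventually_lt_const one_pos
  obtain ⟨n₀, hn₀⟩ := eventually_atTop.1 (hstep.and hsmall)
  -- `2 * C / δ` is the fixed point of the recursion, so any larger bound propagates.
  let D := max (v n₀) (2 * C / δ)
  have hD : 2 * C ≤ D * δ := (div_le_iff₀ hδ).1 (le_max_right _ _)
  have hv : ∀ n, n₀ ≤ n → v n ≤ D := by
    intro n hn
    induction n, hn using Nat.le_induction with
    | base => exact le_max_left _ _
    | succ n hn ih =>
      obtain ⟨h1, h2⟩ := hn₀ n hn
      nlinarith [mul_le_mul_of_nonneg_left ih (sub_nonneg.2 h2.le),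
        mul_le_mul_of_nonneg_right hD (hα n).le]
  refine ⟨D, (by positivity : (0 : ℝ) ≤ 2 * C / δ).trans (le_max_right _ _),
    (eventually_ge_atTop n₀).mono fun n hn => ?_⟩
  rw [Real.rpow_neg (by positivity), ← div_eq_mul_inv, le_div_iff₀ (by positivity), mul_comm]
  exact hv n hn

/-- Rate of a linear stochastic approximation along a fixed noise path. The noise enters only
through the tails `R`, `U` of its weighted sums, which are removed by the change of variables
`x + R x + U`. -/
lemma exists_eventually_seminorm_le {E : Type*} [NormedAddCommGroup E] [NormedSpace ℝ E]
    {p : Seminorm ℝ E} {K₁ K₂ : ℝ} (hK₁ : ∀ x, p x ≤ K₁ * ‖x‖) (hK₂ : ∀ x, ‖x‖ ≤ K₂ * p x)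
    (hK₁0 : 0 ≤ K₁) (hK₂0 : 0 ≤ K₂)
    {Abar : E →L[ℝ] E} {A R : ℕ → E →L[ℝ] E} {x ξ U : ℕ → E} {α : ℕ → ℝ}
    {lam β K C s r δ : ℝ}
    (hx : ∀ n, x (n + 1) = x n + α n • (A n (x n) + ξ n))
    (hR : ∀ n, R (n + 1) = R n - α n • (A n - Abar)) (hU : ∀ n, U (n + 1) = U n - α n • ξ n)
    (hA : ∀ n, ‖A n‖ ≤ K) (hξ : ∀ n, ‖ξ n‖ ≤ K) (hC : 0 ≤ C)
    (hRC : ∀ n : ℕ, ‖R n‖ ≤ C * ((n : ℝ) + 1) ^ (-s))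
    (hUC : ∀ n : ℕ, ‖U n‖ ≤ C * ((n : ℝ) + 1) ^ (-s))
    (hβ : 0 < β) (hcontr : ∀ t, 0 ≤ t → t ≤ β → ∀ y, p (y + t • Abar y) ≤ (1 - lam * t) * p y)
    (hα : ∀ n, 0 < α n) (hα0 : Tendsto α atTop (𝓝 0)) (hr : 0 < r) (hr1 : r ≤ 1)
    (hrs : r ≤ s) (hδ : 0 < δ)
    (hrate : ∀ᶠ n : ℕ in atTop, r / ((n : ℝ) + 1) ≤ (lam - 2 * δ) * α n) :
    ∃ D, ∀ᶠ n : ℕ in atTop, p (x n) ≤ D * ((n : ℝ) + 1) ^ (-r) := by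
  have hs : 0 < s := hr.trans_le hrs
  have hK : 0 ≤ K := (norm_nonneg _).trans (hξ 0)
  let θ : ℕ → ℝ := fun n => ((n : ℝ) + 1) ^ (-s)
  have hθ0 : ∀ n, 0 < θ n := fun n => by positivity
  let y : ℕ → E := fun n => x n + R n (x n) + U n
  -- The steps of `R` and `U` cancel `A n - Abar` and `ξ n`; every remaining term carries a factor
  -- `R` or `U`.
  let e : ℕ → E := fun n => R (n + 1) (A n (x n) + ξ n) - Abar (R n (x n) + U n)
  have hy : ∀ n, y (n + 1) = (y n + α n • Abar (y n)) + α n • e n := by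
    intro n
    have h1 : R (n + 1) (x (n + 1)) =
        R n (x n) - α n • (A n (x n) - Abar (x n)) + α n • R (n + 1) (A n (x n) + ξ n) := by
      rw [hx, map_add, map_smul, hR]
      simp
    simp only [y, e]
    rw [h1, hx, hU]
    simp only [map_add]
    module
  have hRx : ∀ n, ‖R n (x n)‖ ≤ C * θ n * ‖x n‖ := fun n =>
    (R n).le_of_opNorm_le (hRC n) _
  have hsmall : ∀ᶠ n : ℕ in atTop, C * θ n < 1 / 2 := by
    have := (tendsto_nat_succ_rpow_neg hs).const_mul C
    rw [mul_zero] at this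
    exact this.eventually_lt_const (by norm_num)
  -- Once `‖R n‖ < 1/2`, the term `R n (x n)` is absorbed on the left.
  have hxy : ∀ᶠ n : ℕ in atTop, ‖x n‖ ≤ 2 * ‖y n‖ + 2 * (C * θ n) := by
    filter_upwards [hsmall] with n hn
    have h1 : x n = y n - R n (x n) - U n := by simp only [y]; abel
    have h2 : ‖x n‖ ≤ ‖y n‖ + ‖R n (x n)‖ + ‖U n‖ := by
      conv_lhs => rw [h1]
      exact (norm_sub_le _ _).trans (add_le_add_left (norm_sub_le _ _) _)
    have h3 := hUC n
    have h4 := hRx n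
    have h5 := mul_le_mul_of_nonneg_right hn.le (norm_nonneg (x n))
    simp only [θ] at *
    linarith
  have hrec : ∀ᶠ n : ℕ in atTop, p (y (n + 1)) ≤ (1 - lam * α n) * p (y n) +
      α n * (K₁ * (2 * (K + ‖Abar‖) * C * (K₂ + 1)) * ((n : ℝ) + 1) ^ (-s) * (p (y n) + 1)) := by
    filter_upwards [hsmall, hxy, hα0.eventually_lt_const hβ] with n h1 h2 h3
    have hx1 : ‖x n‖ + 1 ≤ 2 * (K₂ + 1) * (p (y n) + 1) := by
      have := hK₂ (y n)
      have h0 : 0 ≤ p (y n) := apply_nonneg _ _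
      nlinarith
    have he : ‖e n‖ ≤ (K + ‖Abar‖) * C * θ n * (‖x n‖ + 1) := by
      have e1 : ‖R (n + 1) (A n (x n) + ξ n)‖ ≤ C * θ n * (K * (‖x n‖ + 1)) := by
        have i1 : ‖R (n + 1)‖ ≤ C * θ n := (hRC (n + 1)).trans
          (mul_le_mul_of_nonneg_left (antitone_nat_succ_rpow_neg hs.le (Nat.le_succ n)) hC)
        have i2 : ‖A n (x n) + ξ n‖ ≤ K * (‖x n‖ + 1) := by
          refine (norm_add_le _ _).trans ?_
          have := (A n).le_of_opNorm_le (hA n) (x n)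
          have := hξ n
          linarith
        exact ((R (n + 1)).le_opNorm _).trans
          (mul_le_mul i1 i2 (norm_nonneg _) (mul_nonneg hC (hθ0 n).le))
      have e2 : ‖Abar (R n (x n) + U n)‖ ≤ ‖Abar‖ * (C * θ n * (‖x n‖ + 1)) := by
        refine (Abar.le_opNorm _).trans (mul_le_mul_of_nonneg_left ?_ (norm_nonneg _))
        refine (norm_add_le _ _).trans ?_
        have i1 := hRx n
        have i2 : ‖U n‖ ≤ C * θ n := hUC n
        linarith
      refine (norm_sub_le _ _).trans ((add_le_add e1 e2).trans_eq ?_)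
      ring
    rw [hy]
    refine (map_add_le_add p _ _).trans
      (add_le_add (hcontr _ (hα n).le h3.le _) ?_)
    rw [map_smul_eq_mul, Real.norm_eq_abs, abs_of_pos (hα n)]
    refine mul_le_mul_of_nonneg_left ?_ (hα n).le
    calc p (e n) ≤ K₁ * ‖e n‖ := hK₁ _
      _ ≤ K₁ * ((K + ‖Abar‖) * C * θ n * (‖x n‖ + 1)) := by gcongr
      _ ≤ K₁ * ((K + ‖Abar‖) * C * θ n * (2 * (K₂ + 1) * (p (y n) + 1))) := by
        have := (hθ0 n).le
        gcongr
      _ = _ := by simp only [θ]; ring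
  obtain ⟨D, hD, hyD⟩ := exists_eventually_le_of_recursion (z := fun n => p (y n))
    (fun n => apply_nonneg _ _) hα hα0 (by positivity) hr hr1 hrs hδ hrate hrec
  refine ⟨K₁ * (2 * (K₂ * D) + 2 * C), ?_⟩
  filter_upwards [hxy, hyD] with n h1 h2
  have hθr : θ n ≤ ((n : ℝ) + 1) ^ (-r) :=
    Real.rpow_le_rpow_of_exponent_le (by linarith [n.cast_nonneg (α := ℝ)]) (by linarith)
  rw [mul_assoc]
  refine (hK₁ _).trans (mul_le_mul_of_nonneg_left ?_ hK₁0)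
  have h3 := (hK₂ (y n)).trans (mul_le_mul_of_nonneg_left h2 hK₂0)
  have h4 := mul_le_mul_of_nonneg_left hθr hC
  linarith

/-! ### Contracting norms for Hurwitz matrices -/

open scoped Matrix.Norms.Operator NNReal ENNReal in
/-- A real matrix all of whose complex eigenvalues lie in the open unit disc has a power of norm
less than one. -/
lemma Matrix.exists_norm_pow_lt_one {d : ℕ} [Nonempty (Fin d)] {B : Matrix (Fin d) (Fin d) ℝ}
    (hB : ∀ z ∈ spectrum ℂ (B.map Complex.ofReal), ‖z‖ < 1) :
    ∃ m : ℕ, 0 < m ∧ ‖B ^ m‖ < 1 := by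
  have h1 : spectralRadius ℂ (B.map Complex.ofReal) < ((1 : ℝ≥0) : ℝ≥0∞) :=
    spectrum.spectralRadius_lt_of_forall_lt _ fun z hz => hB z hz
  have h2 := spectrum.pow_nnnorm_pow_one_div_tendsto_nhds_spectralRadius (B.map Complex.ofReal)
  obtain ⟨m, hm, hm0⟩ := ((h2.eventually_lt_const h1).and (eventually_gt_atTop 0)).exists
  refine ⟨m, hm0, ?_⟩
  have h3 : ‖(B.map Complex.ofReal) ^ m‖ < 1 := by
    by_contra hcon
    have h4 : (1 : ℝ≥0∞) ≤ (‖(B.map Complex.ofReal) ^ m‖₊ : ℝ≥0∞) := by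
      exact_mod_cast not_lt.1 hcon
    exact absurd hm (not_lt.2 (by simpa using ENNReal.one_le_rpow h4 (by positivity)))
  have h5 : (B.map Complex.ofReal) ^ m = (B ^ m).map Complex.ofReal :=
    (map_pow (Complex.ofRealHom.mapMatrix) B m).symm
  rw [h5] at h3
  rw [linfty_opNorm_def] at h3 ⊢
  simpa using h3

open scoped Matrix.Norms.Operator in
/-- A real matrix with a power of norm less than one contracts some norm. -/
lemma Matrix.exists_seminorm_mulVec_le {d : ℕ} {B : Matrix (Fin d) (Fin d) ℝ} {m : ℕ} (hm : 0 < m)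
    (hB : ‖B ^ m‖ < 1) :
    ∃ (p : Seminorm ℝ (Fin d → ℝ)) (κ : ℝ), 0 < κ ∧ κ < 1 ∧ (∀ w, p w = 0 → w = 0) ∧
      ∀ w, p (B.mulVec w) ≤ κ * p w := by
  obtain ⟨κ, hκ0, hκ1, hκ⟩ : ∃ κ : ℝ, 0 < κ ∧ κ < 1 ∧ ‖B ^ m‖ ≤ κ ^ m := by
    have h1 : Tendsto (fun κ : ℝ => κ ^ m) (𝓝[<] 1) (𝓝 1) := by
      have : Tendsto (fun κ : ℝ => κ ^ m) (𝓝 1) (𝓝 (1 ^ m)) := (continuous_pow m).tendsto 1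
      rw [one_pow] at this
      exact this.mono_left nhdsWithin_le_nhds
    obtain ⟨κ, h4, h2, h3⟩ := ((h1.eventually_const_lt hB).and
      (Ioo_mem_nhdsLT (zero_lt_one (α := ℝ)))).exists
    exact ⟨κ, h2, h3, h4.le⟩
  -- Applying `B` moves term `k` to term `k + 1` at the cost of a factor `κ`; the last term closes
  -- the cycle by `‖B ^ m‖ ≤ κ ^ m`. Term `k = 0` makes `p` definite.
  let p : Seminorm ℝ (Fin d → ℝ) := Seminorm.of
    (fun w => ∑ k ∈ Finset.range m, κ ^ (m - 1 - k) * ‖(B ^ k).mulVec w‖)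
    (fun w w' => by
      rw [← Finset.sum_add_distrib]
      refine Finset.sum_le_sum fun k _ => ?_
      rw [← mul_add, Matrix.mulVec_add]
      exact mul_le_mul_of_nonneg_left (norm_add_le _ _) (by positivity))
    (fun t w => by
      rw [Finset.mul_sum]
      refine Finset.sum_congr rfl fun k _ => ?_
      rw [Matrix.mulVec_smul, norm_smul]
      ring)
  have hp : ∀ w, p w = ∑ k ∈ Finset.range m, κ ^ (m - 1 - k) * ‖(B ^ k).mulVec w‖ :=
    fun w => rfl
  refine ⟨p, κ, hκ0, hκ1, fun w hw => ?_, fun w => ?_⟩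
  · rw [hp] at hw
    have := (Finset.sum_eq_zero_iff_of_nonneg fun k _ => by positivity).1 hw 0
      (Finset.mem_range.2 hm)
    simpa [hκ0.ne'] using this
  · obtain ⟨m, rfl⟩ : ∃ l, m = l + 1 := ⟨m - 1, by omega⟩
    rw [hp, hp, Finset.sum_range_succ, Finset.sum_range_succ', mul_add, Finset.mul_sum]
    refine add_le_add (Finset.sum_le_sum fun k hk => le_of_eq ?_) ?_
    · have hk := Finset.mem_range.1 hk
      rw [Matrix.mulVec_mulVec, ← pow_succ, ← mul_assoc, ← pow_succ']
      congr 2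
      omega
    · rw [Matrix.mulVec_mulVec, ← pow_succ]
      refine (mul_le_mul_of_nonneg_left ((Matrix.linfty_opNorm_mulVec _ _).trans
        (mul_le_mul_of_nonneg_right hκ (norm_nonneg w))) (by positivity)).trans_eq ?_
      simp
      ring

/-- A forward Euler step of a Hurwitz matrix contracts some norm. -/
lemma IsHurwitz.exists_seminorm {d : ℕ} {H : Matrix (Fin d) (Fin d) ℝ} (hH : IsHurwitz H) :
    ∃ (β : ℝ) (p : Seminorm ℝ (Fin d → ℝ)) (κ : ℝ), 0 < β ∧ 0 < κ ∧ κ < 1 ∧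
      (∀ w, p w = 0 → w = 0) ∧ ∀ w, p (w + β • H.mulVec w) ≤ κ * p w := by
  rcases isEmpty_or_nonempty (Fin d) with hd | hd
  · exact ⟨1, normSeminorm ℝ _, 1 / 2, by norm_num, by norm_num, by norm_num,
      fun w _ => Subsingleton.elim _ _, fun w => by
        rw [Subsingleton.elim w 0]; simp⟩
  · obtain ⟨β, hβ, hβz⟩ : ∃ β : ℝ, 0 < β ∧
        ∀ z ∈ spectrum ℂ (H.map Complex.ofReal), ‖1 + (β : ℂ) * z‖ < 1 := by
      have hfin : (spectrum ℂ (H.map Complex.ofReal)).Finite := Matrix.finite_spectrum _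
      have hev : ∀ᶠ β : ℝ in 𝓝[>] 0,
          ∀ z ∈ spectrum ℂ (H.map Complex.ofReal), ‖1 + (β : ℂ) * z‖ < 1 := by
        rw [hfin.eventually_all]
        intro z hz
        have hre := hH z hz
        -- This is the first-order coefficient in `|1 + βz|² = 1 + β(β|z|² + 2 Re z)`; it is
        -- negative for small `β`.
        have h1 : Tendsto (fun β : ℝ => β * Complex.normSq z + 2 * z.re) (𝓝[>] 0)
            (𝓝 (0 * Complex.normSq z + 2 * z.re)) :=
          ((tendsto_id.mul_const _).add_const _).mono_left nhdsWithin_le_nhds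
        filter_upwards [h1.eventually_lt_const (u := 0) (by linarith), self_mem_nhdsWithin]
          with β h2 (h3 : 0 < β)
        have h4 : Complex.normSq (1 + (β : ℂ) * z) =
            1 + β * (β * Complex.normSq z + 2 * z.re) := by
          simp only [Complex.normSq_apply, Complex.add_re, Complex.add_im, Complex.mul_re,
            Complex.mul_im, Complex.ofReal_re, Complex.ofReal_im, Complex.one_re, Complex.one_im]
          ring
        rw [← sq_lt_one_iff₀ (norm_nonneg _), ← Complex.normSq_eq_norm_sq, h4]
        nlinarith
      obtain ⟨β, h1, h2⟩ := (hev.and self_mem_nhdsWithin).exists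
      exact ⟨β, h2, h1⟩
    have hspec : ∀ z ∈ spectrum ℂ ((1 + β • H).map Complex.ofReal), ‖z‖ < 1 := by
      intro z hz
      have e : (1 + β • H).map Complex.ofReal =
          algebraMap ℂ (Matrix (Fin d) (Fin d) ℂ) 1 +
            (Units.mk0 (β : ℂ) (by exact_mod_cast hβ.ne')) • H.map Complex.ofReal := by
        rw [map_one, Units.smul_mk0]
        ext i j
        simp [Matrix.one_apply, apply_ite Complex.ofReal]
      rw [e, ← spectrum.singleton_add_eq, spectrum.unit_smul_eq_smul] at hz
      obtain ⟨_, rfl, _, ⟨v, hv, rfl⟩, rfl⟩ := hz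
      simpa [Units.smul_def] using hβz v hv
    obtain ⟨m, hm, hnorm⟩ := Matrix.exists_norm_pow_lt_one hspec
    obtain ⟨p, κ, h0, h1, h2, h3⟩ := Matrix.exists_seminorm_mulVec_le hm hnorm
    refine ⟨β, p, κ, hβ, h0, h1, h2, fun w => ?_⟩
    simpa [Matrix.add_mulVec, Matrix.smul_mulVec] using h3 w

/-- A definite seminorm on `ℝ^d` is equivalent to the sup norm. -/
lemma Seminorm.exists_equiv_norm {d : ℕ} (p : Seminorm ℝ (Fin d → ℝ))
    (hp : ∀ w, p w = 0 → w = 0) :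
    ∃ K₁ K₂ : ℝ, 0 ≤ K₁ ∧ 0 ≤ K₂ ∧ (∀ x, p x ≤ K₁ * ‖x‖) ∧ ∀ x, ‖x‖ ≤ K₂ * p x := by
  have h1 : ∀ x, p x ≤ (∑ i, p (Pi.single i 1)) * ‖x‖ := by
    intro x
    have e : x = ∑ i, x i • (Pi.single i 1 : Fin d → ℝ) := by
      rw [← pi_eq_sum_univ' x]
    conv_lhs => rw [e]
    refine (Finset.le_sum_of_subadditive p (map_zero p).le (map_add_le_add p) _ _).trans ?_
    rw [Finset.sum_mul]
    refine Finset.sum_le_sum fun i _ => ?_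
    rw [map_smul_eq_mul, mul_comm]
    exact mul_le_mul_of_nonneg_left (norm_le_pi_norm x i) (apply_nonneg _ _)
  have h0 : 0 ≤ ∑ i, p (Pi.single i 1) := Finset.sum_nonneg fun i _ => apply_nonneg _ _
  have hcont : Continuous p := by
    refine (LipschitzWith.of_dist_le_mul (K := ⟨_, h0⟩) fun x y => ?_).continuous
    rw [Real.dist_eq, dist_eq_norm]
    exact (abs_sub_map_le_sub p x y).trans (h1 _)
  rcases (Metric.sphere (0 : Fin d → ℝ) 1).eq_empty_or_nonempty with hS | hS
  · refine ⟨_, 0, h0, le_rfl, h1, fun x => ?_⟩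
    by_contra hx
    have hx0 : 0 < ‖x‖ := by simpa using hx
    have : ‖x‖⁻¹ • x ∈ Metric.sphere (0 : Fin d → ℝ) 1 := by
      simp [norm_smul, hx0.ne']
    rw [hS] at this
    exact this
  · obtain ⟨z, hz, hmin⟩ := (isCompact_sphere (0 : Fin d → ℝ) 1).exists_isMinOn hS
      hcont.continuousOn
    have hz1 : ‖z‖ = 1 := by simpa using hz
    have hpz : 0 < p z := lt_of_le_of_ne (apply_nonneg _ _) fun h => by
      rw [hp z h.symm, norm_zero] at hz1
      exact zero_ne_one hz1
    refine ⟨_, (p z)⁻¹, h0, by positivity, h1, fun x => ?_⟩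
    rcases eq_or_ne x 0 with rfl | hx
    · simp
    have hx0 : 0 < ‖x‖ := norm_pos_iff.2 hx
    have h2 : p z ≤ p (‖x‖⁻¹ • x) := hmin (by simp [norm_smul, hx0.ne'])
    rw [map_smul_eq_mul, norm_inv, norm_norm, inv_mul_eq_div, le_div_iff₀ hx0] at h2
    rw [inv_mul_eq_div, le_div_iff₀ hpz]
    linarith

/-! ### From empirical sums to the rate -/

/-- Tails of the step-size weighted sums of a centred function along a path whose empirical
measures converge at a polynomial rate. -/
lemma exists_tail_of_indicator_sums {W : Type*} [Fintype W] [DecidableEq W] {Y : ℕ → W}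
    {q : W → ℝ} {a η s : ℝ} (hs : 0 < s)
    (hY : ∀ y, ∃ l, Tendsto (fun n => ∑ k ∈ Finset.range n,
      ((k : ℝ) + 1) ^ (-(η - s)) * ((if Y k = y then 1 else 0) - q y)) atTop (𝓝 l))
    {E : Type*} [NormedAddCommGroup E] [NormedSpace ℝ E] [CompleteSpace E] {F : W → E}
    (hF : ∑ y, q y • F y = 0) :
    ∃ R : ℕ → E, (∀ n : ℕ, R (n + 1) = R n - (a / ((n : ℝ) + 1) ^ η) • F (Y n)) ∧
      ∃ C, 0 ≤ C ∧ ∀ n : ℕ, ‖R n‖ ≤ C * ((n : ℝ) + 1) ^ (-s) := by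
  choose l hl using hY
  -- Since `F` is centred, `F (Y k)` is the combination of the `F y` with coefficients `1{Y k = y} -
  -- q y`. The missing factor `(k+1)^(-s)` of the step size is left for Abel summation.
  have h1 : Tendsto (fun n => ∑ k ∈ Finset.range n,
      (a * ((k : ℝ) + 1) ^ (-(η - s))) • F (Y k)) atTop (𝓝 (a • ∑ y, l y • F y)) := by
    refine ((tendsto_finsetSum Finset.univ fun y _ =>
      (hl y).smul_const (F y)).const_smul a).congr fun n => ?_
    simp only [Finset.sum_smul]
    rw [Finset.sum_comm, Finset.smul_sum]
    refine Finset.sum_congr rfl fun k _ => ?_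
    simp only [mul_smul, sub_smul, smul_sub, Finset.sum_sub_distrib, ← Finset.smul_sum, hF]
    simp
  obtain ⟨R, hR, hC⟩ := exists_tail_of_tendsto_sum (antitone_nat_succ_rpow_neg hs.le)
    (tendsto_nat_succ_rpow_neg hs) h1
  refine ⟨R, fun n => ?_, hC⟩
  rw [hR, smul_smul]
  congr 2
  have hn : (0 : ℝ) < (n : ℝ) + 1 := by positivity
  rw [div_eq_mul_inv, ← Real.rpow_neg hn.le, mul_left_comm, ← Real.rpow_add hn]
  congr 2
  ring

namespace FiniteMDP

variable {S A : Type*} [Fintype S] [Fintype A] {d N : ℕ} (M : FiniteMDP S A)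
  (φ : S × A → Fin d → ℝ) (c ρ : S × A → ℝ)

open Matrix in
lemma gtdIncrement_eq {S A : Type*} [Fintype S] (M : FiniteMDP S A)
    (φ : S × A → Fin d → ℝ) (c ρ : S × A → ℝ) (w : Fin d → ℝ) (y : Window S A N) :
    M.gtdIncrement φ c ρ w y = M.gtdMatrix φ c ρ y *ᵥ w - M.gtdVector φ c y := by
  rw [gtdIncrement, gtdMatrix, gtdVector, vecMulVec_mulVec, sub_neg_eq_add, op_smul_eq_smul,
    ← add_smul, sum_dotProduct, ← Finset.sum_add_distrib]
  congr 1
  refine Finset.sum_congr rfl fun i _ => ?_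
  simp only [smul_dotProduct, sub_dotProduct, tdError, smul_eq_mul]
  ring

-- For `t ≤ β`, `I + tĀ` is a convex combination of `I` and the contraction `I + βĀ`.
open Matrix in
lemma IsGTDContraction.mulVec_le {M : FiniteMDP S A} {φ : S × A → Fin d → ℝ} {c ρ : S × A → ℝ}
    {q : Window S A N → ℝ} {β κ : ℝ} {nrm : Seminorm ℝ (Fin d → ℝ)}
    (h : M.IsGTDContraction φ c ρ q β nrm κ) {t : ℝ} (ht : 0 ≤ t) (htβ : t ≤ β)
    (w : Fin d → ℝ) :
    nrm (w + t • (M.gtdMeanMatrix φ c ρ q *ᵥ w)) ≤ (1 - (1 - κ) / β * t) * nrm w := by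
  have hβ := h.β_pos
  have h1 : nrm (w + β • (M.gtdMeanMatrix φ c ρ q *ᵥ w)) ≤ κ * nrm w := by
    have := h.contraction w 0
    have e : M.gtdMap φ c ρ q β w - M.gtdMap φ c ρ q β 0 =
        w + β • (M.gtdMeanMatrix φ c ρ q *ᵥ w) := by
      simp only [gtdMap, mulVec_zero]
      module
    rwa [e, sub_zero] at this
  have e : w + t • (M.gtdMeanMatrix φ c ρ q *ᵥ w) =
      (1 - t / β) • w + (t / β) • (w + β • (M.gtdMeanMatrix φ c ρ q *ᵥ w)) := by
    rw [smul_add, smul_smul, div_mul_cancel₀ _ hβ.ne']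
    module
  have h2 : t / β ≤ 1 := (div_le_one hβ).2 htβ
  rw [e]
  refine (map_add_le_add _ _ _).trans ?_
  rw [map_smul_eq_mul, map_smul_eq_mul, Real.norm_eq_abs, Real.norm_eq_abs,
    abs_of_nonneg (sub_nonneg.2 h2), abs_of_nonneg (by positivity)]
  have := mul_le_mul_of_nonneg_left h1 (show 0 ≤ t / β by positivity)
  calc _ ≤ (1 - t / β) * nrm w + t / β * (κ * nrm w) := by gcongr
    _ = _ := by ring

-- A kernel vector of `Ā` would be fixed by the contraction `I + βĀ`, so `Ā` is invertible.
open Matrix in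
lemma IsGTDContraction.mulVec_gtdRoot {M : FiniteMDP S A} {φ : S × A → Fin d → ℝ}
    {c ρ : S × A → ℝ} {q : Window S A N → ℝ} {β κ : ℝ} {nrm : Seminorm ℝ (Fin d → ℝ)}
    (h : M.IsGTDContraction φ c ρ q β nrm κ) :
    M.gtdMeanMatrix φ c ρ q *ᵥ M.gtdRoot φ c ρ q = M.gtdMeanVector φ c q := by
  have hinj : Function.Injective (M.gtdMeanMatrix φ c ρ q).mulVec := by
    intro w w' hw
    rw [← sub_eq_zero]
    refine h.norm_definite _ ?_
    have h1 := h.mulVec_le h.β_pos.le le_rfl (w - w')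
    have hw' : M.gtdMeanMatrix φ c ρ q *ᵥ w = M.gtdMeanMatrix φ c ρ q *ᵥ w' := hw
    rw [mulVec_sub, hw', sub_self, smul_zero, add_zero, div_mul_cancel₀ _ h.β_pos.ne'] at h1
    have h2 : 0 ≤ nrm (w - w') := apply_nonneg _ _
    nlinarith [h.κ_lt_one]
  rw [gtdRoot, mulVec_mulVec, mul_nonsing_inv _
    ((isUnit_iff_isUnit_det _).1 (mulVec_injective_iff_isUnit.1 hinj)), one_mulVec]

lemma exists_isGTDContraction {q : Window S A N → ℝ}
    (hHur : IsHurwitz (M.gtdMeanMatrix φ c ρ q)) :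
    ∃ β nrm κ, M.IsGTDContraction φ c ρ q β nrm κ := by
  obtain ⟨β, p, κ, hβ, h0, h1, h2, h3⟩ := hHur.exists_seminorm
  refine ⟨β, p, κ, hβ, h0, h1, h2, fun w w' => ?_⟩
  have e : M.gtdMap φ c ρ q β w - M.gtdMap φ c ρ q β w' =
      (w - w') + β • (M.gtdMeanMatrix φ c ρ q).mulVec (w - w') := by
    simp only [gtdMap, Matrix.mulVec_sub]
    module
  rw [e]
  exact h3 _

open Matrix in
/-- Rate of the generalized TD iterates along a fixed path of windows. -/
lemma IsGTDContraction.exists_eventually_le [DecidableEq (Window S A N)]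
    {M : FiniteMDP S A} {φ : S × A → Fin d → ℝ}
    {c ρ : S × A → ℝ} {q : Window S A N → ℝ} {β κ : ℝ} {nrm : Seminorm ℝ (Fin d → ℝ)}
    (h : M.IsGTDContraction φ c ρ q β nrm κ) (hq : ∑ y, q y = 1) {a η r δ : ℝ} (ha : 0 < a)
    (hη : 0 < η) (hr : 0 < r) (hr1 : r ≤ 1) (hδ : 0 < δ)
    (hrate : ∀ᶠ n : ℕ in atTop,
      r / ((n : ℝ) + 1) ≤ ((1 - κ) / β - 2 * δ) * (a / ((n : ℝ) + 1) ^ η))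
    {Y : ℕ → Window S A N}
    (hY : ∀ y, ∃ l, Tendsto (fun n => ∑ k ∈ Finset.range n,
      ((k : ℝ) + 1) ^ (-(η - r)) * ((if Y k = y then 1 else 0) - q y)) atTop (𝓝 l))
    (w₀ : Fin d → ℝ) :
    ∃ D, ∀ᶠ n : ℕ in atTop,
      nrm (M.gtdIterate φ c ρ a η w₀ Y n - M.gtdRoot φ c ρ q) ≤ D * ((n : ℝ) + 1) ^ (-r) := by
  let L : Matrix (Fin d) (Fin d) ℝ →ₗ[ℝ] ((Fin d → ℝ) →L[ℝ] (Fin d → ℝ)) :=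
    LinearMap.toContinuousLinearMap.toLinearMap ∘ₗ (toLin' (R := ℝ)).toLinearMap
  have hL : ∀ B v, L B v = B *ᵥ v := fun B v => by simp [L]
  let Abar := M.gtdMeanMatrix φ c ρ q
  let wr := M.gtdRoot φ c ρ q
  let ξ : Window S A N → Fin d → ℝ := fun y => M.gtdMatrix φ c ρ y *ᵥ wr - M.gtdVector φ c y
  have hξ : ∑ y, q y • ξ y = 0 := by
    have e := h.mulVec_gtdRoot
    rw [gtdMeanMatrix, gtdMeanVector, sum_mulVec] at e
    simp only [smul_mulVec] at e
    simp only [ξ, smul_sub, Finset.sum_sub_distrib, wr, e, sub_self]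
  have hA : ∑ y, q y • (L (M.gtdMatrix φ c ρ y) - L Abar) = 0 := by
    simp only [smul_sub, Finset.sum_sub_distrib, ← map_smul, ← map_sum, ← Finset.sum_smul, hq]
    simp only [Abar, gtdMeanMatrix, one_smul, sub_self]
  obtain ⟨R, hR, C₁, hC₁, hRC⟩ := exists_tail_of_indicator_sums (a := a) hr hY hA
  obtain ⟨U, hU, C₂, hC₂, hUC⟩ := exists_tail_of_indicator_sums (a := a) hr hY hξ
  obtain ⟨K₁, K₂, hK₁0, hK₂0, hK₁, hK₂⟩ := nrm.exists_equiv_norm h.norm_definite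
  obtain ⟨B₁, hB₁⟩ := (Set.finite_range fun y : Window S A N =>
    ‖L (M.gtdMatrix φ c ρ y)‖).bddAbove
  obtain ⟨B₂, hB₂⟩ := (Set.finite_range fun y : Window S A N => ‖ξ y‖).bddAbove
  refine exists_eventually_seminorm_le (p := nrm) hK₁ hK₂ hK₁0 hK₂0 (Abar := L Abar)
    (A := fun n => L (M.gtdMatrix φ c ρ (Y n))) (R := R) (ξ := fun n => ξ (Y n)) (U := U)
    (α := fun n : ℕ => a / ((n : ℝ) + 1) ^ η) (lam := (1 - κ) / β) (β := β) (K := max B₁ B₂)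
    (C := max C₁ C₂) (s := r) (δ := δ) ?_ hR hU
    (fun n => (hB₁ ⟨Y n, rfl⟩).trans (le_max_left _ _))
    (fun n => (hB₂ ⟨Y n, rfl⟩).trans (le_max_right _ _)) (hC₁.trans (le_max_left _ _))
    (fun n => (hRC n).trans (by gcongr; exact le_max_left _ _))
    (fun n => (hUC n).trans (by gcongr; exact le_max_right _ _)) h.β_pos
    (fun t ht htβ w => by rw [hL]; exact h.mulVec_le ht htβ w) (fun n => by positivity) ?_ hr hr1
    le_rfl hδ hrate
  · intro n
    rw [gtdIterate, gtdIncrement_eq, hL]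
    simp only [ξ, wr, mulVec_sub]
    module
  · have := (tendsto_nat_succ_rpow_neg hη).const_mul a
    rw [mul_zero] at this
    refine this.congr fun n => ?_
    rw [Real.rpow_neg (by positivity), div_eq_mul_inv]

end FiniteMDP

/-- The bound `r < η - 1/2` is square summability of `(k+1)^(-(η-r))`. For `η < 1` the step size
dominates `1/n`, so the rate condition is free; for `η = 1` it requires `r < lam * a`, and the
chosen `δ` gives equality. -/
lemma exists_rate_exponent {lam a η ζ : ℝ} (hlam : 0 < lam) (ha : 0 < a)
    (h : (η < 1 ∧ ζ < 2 * η - 1) ∨ (η = 1 ∧ ζ < min 1 (2 * (lam * a)))) :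
    ∃ r δ : ℝ, ζ < 2 * r ∧ r < η - 1 / 2 ∧ 0 < δ ∧ ∀ᶠ n : ℕ in atTop,
      r / ((n : ℝ) + 1) ≤ (lam - 2 * δ) * (a / ((n : ℝ) + 1) ^ η) := by
  rcases h with ⟨hη1, h⟩ | ⟨rfl, h⟩
  · obtain ⟨r, hr1, hr2⟩ := exists_between (show ζ / 2 < η - 1 / 2 by linarith)
    refine ⟨r, lam / 4, by linarith, hr2, by positivity, ?_⟩
    have h1 := (tendsto_nat_succ_rpow_neg (s := 1 - η) (by linarith)).const_mul r
    rw [mul_zero] at h1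
    filter_upwards [h1.eventually_lt_const (show 0 < lam / 2 * a by positivity)] with n hn
    have hn0 : (0 : ℝ) < (n : ℝ) + 1 := by positivity
    have e : r / ((n : ℝ) + 1) = r * ((n : ℝ) + 1) ^ (-(1 - η)) / ((n : ℝ) + 1) ^ η := by
      rw [mul_div_assoc, ← Real.rpow_sub hn0]
      rw [show -(1 - η) - η = -1 by ring, Real.rpow_neg_one, div_eq_mul_inv]
    rw [e, ← mul_div_assoc]
    refine div_le_div_of_nonneg_right ?_ (by positivity)
    linarith
  · obtain ⟨h1, h2⟩ := lt_min_iff.1 h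
    obtain ⟨r, hr1, hr2⟩ := exists_between
      (show ζ / 2 < min (1 / 2) (lam * a) from lt_min (by linarith) (by linarith))
    obtain ⟨h3, h4⟩ := lt_min_iff.1 hr2
    refine ⟨r, (lam - r / a) / 2, by linarith, by linarith, ?_, Eventually.of_forall fun n => ?_⟩
    · have := (div_lt_iff₀ ha).2 h4
      linarith
    · rw [Real.rpow_one]
      refine le_of_eq ?_
      field_simp
      ring

/-- Almost sure rate for single-trajectory generalized TD. Under the Hurwitz condition, the
averaged map is a contraction for some step `β`, norm `nrm` and factor `κ`, and the rate holds for
every such choice. -/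
theorem theorem2 {S A : Type*} [Fintype S] [Fintype A] [DecidableEq S] [DecidableEq A]
    (M : FiniteMDP S A)
    -- the behavior policy, with strict coverage and an irreducible aperiodic chain
    (b : RandPolicy S A) (hcov : ∀ s a, 0 < b.prob s a)
    (hirr : (M.stateActionMatrix b).IsIrreducible)
    (haper : IsAperiodicChain (M.stateActionMatrix b))
    -- the horizon, the features and the generalized importance sampling factors
    {N d : ℕ} (hN : 1 ≤ N) (φ : S × A → Fin d → ℝ)
    (c ρ : S × A → ℝ) (hc : ∀ x, 0 ≤ c x) (hρ : ∀ x, 0 ≤ ρ x)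
    -- the invariant distribution of the window chain and the Hurwitz condition
    (q : Window S A N → ℝ) (hq : IsInvariantDistribution (M.windowMatrix b N) q)
    (hHur : IsHurwitz (M.gtdMeanMatrix φ c ρ q))
    -- the single trajectory, the step sizes and the deterministic initial iterate
    {Ω : Type*} [MeasurableSpace Ω] (μ : Measure Ω) [IsProbabilityMeasure μ]
    (St : ℕ → Ω → S) (Act : ℕ → Ω → A) (htraj : M.IsTrajectory b μ St Act)
    (a η : ℝ) (ha : 0 < a) (hη : 1 / 2 < η) (hη' : η ≤ 1) (w₀ : Fin d → ℝ) :
    (∃ β nrm κ, M.IsGTDContraction φ c ρ q β nrm κ) ∧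
    ∀ (β : ℝ) (nrm : Seminorm ℝ (Fin d → ℝ)) (κ : ℝ), M.IsGTDContraction φ c ρ q β nrm κ →
      ∀ ζ : ℝ, 0 < ζ →
        ((η < 1 ∧ ζ < 2 * η - 1) ∨ (η = 1 ∧ ζ < min 1 (2 * (1 - κ) * (a / β)))) →
        ∀ᵐ ω ∂μ, Tendsto
          (fun n : ℕ => ((n : ℝ) + 1) ^ ζ *
            nrm (M.gtdIterate φ c ρ a η w₀ (fun k => FiniteMDP.dataWindow N St Act k ω) n
              - M.gtdRoot φ c ρ q) ^ 2)
          atTop (𝓝 0) := by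
  refine ⟨M.exists_isGTDContraction φ c ρ hHur, fun β nrm κ h ζ hζ hcase => ?_⟩
  obtain ⟨r, δ, hζr, hrη, hδ, hrate⟩ := exists_rate_exponent (lam := (1 - κ) / β) (a := a)
    (div_pos (sub_pos.2 h.κ_lt_one) h.β_pos) ha
    (hcase.imp_right fun hc => ⟨hc.1, hc.2.trans_eq (by ring_nf)⟩)
  -- Indicators of the finitely many windows suffice, so one null set serves all matrix and vector
  -- noise.
  have hconv : ∀ᵐ ω ∂μ, ∀ y : Window S A N, ∃ l, Tendsto (fun n => ∑ k ∈ Finset.range n,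
      ((k : ℝ) + 1) ^ (-(η - r)) *
        ((if FiniteMDP.dataWindow N St Act k ω = y then 1 else 0) - q y)) atTop (𝓝 l) := by
    rw [ae_all_iff]
    intro y
    refine htraj.ae_exists_tendsto_sum hirr hq (f := fun z => (if z = y then 1 else 0) - q y)
      ?_ (by linarith)
    simp [mul_sub, Finset.sum_sub_distrib, ← Finset.sum_mul, hq.sum_eq_one]
  filter_upwards [hconv] with ω hω
  obtain ⟨D, hD⟩ := h.exists_eventually_le hq.sum_eq_one ha (by linarith) (by linarith)
    (by linarith) hδ hrate hω w₀
  -- The slack `2 * r - ζ > 0` turns the `O` bound into convergence to zero.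
  have hlim := (tendsto_nat_succ_rpow_neg (s := 2 * r - ζ) (by linarith)).const_mul (D ^ 2)
  rw [mul_zero] at hlim
  refine squeeze_zero' (Eventually.of_forall fun n => by positivity) (hD.mono fun n hn => ?_) hlim
  have hn0 : (0 : ℝ) < (n : ℝ) + 1 := by positivity
  calc _ ≤ ((n : ℝ) + 1) ^ ζ * (D * ((n : ℝ) + 1) ^ (-r)) ^ 2 := by gcongr
    _ = D ^ 2 * (((n : ℝ) + 1) ^ ζ * ((n : ℝ) + 1) ^ (-r * (2 : ℕ))) := by
      rw [Real.rpow_mul_natCast hn0.le]; ring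
    _ = _ := by
      rw [← Real.rpow_add hn0]
      congr 2
      push_cast
      ring
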